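/- Let $G=(V,E)$ be a finite simple triangle-free graph without isolated vertices, and let $d_v$ denote the degree of a vertex $v$. For each $v\in V$ let $\Omega_v$ be a $\sigma$-finite measure space, and for each edge $uv\in E$ let $f_{uv}\colon \Omega_u\times\Omega_v\to\mathbb{R}_{\ge 0}$ be a measurable function, labeled so that $f_{uv}(x_u,x_v)=f_{vu}(x_v,x_u)$. For a nonnegative measurable function $f\colon\Omega_1\times\Omega_2\to\mathbb{R}_{\ge 0}$ on a product of two such spaces and integers $a,b\ge 1$, put $$\|f\|_{K_{a,b}} := \Biggl(\int_{\Omega_1^a\times\Omega_2^b}\ \prod_{1\le i\le a}\ \prod_{1\le j\le b} f(x_i,y_j)\,dx_1\cdots dx_a\,dy_1\cdots dy_b\Biggr)^{1/(ab)}\in[0,\infty].$$ Then $$\int_{\Omega_V}\ \prod_{uv\in E} f_{uv}(x_u,x_v)\,d\boldsymbol{x}_V\ \le\ \prod_{uv\in E}\|f_{uv}\|_{K_{d_v,d_u}},$$ where $\Omega_V:=\prod_{v\in V}\Omega_v$ and $d\boldsymbol{x}_V:=\prod_{v\in V}dx_v$ is the product measure. Integrals of nonnegative functions take values in $[0,\infty]$,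 with the convention $0\cdot\infty=0$. -/

import Mathlib

open MeasureTheory
open scoped NNReal ENNReal

/-- The quantity `‖f‖_{K_{a,b}}` of a nonnegative function `f` on `Ω₁ × Ω₂`, with values in
`[0, ∞]`: the integral over `Ω₁ ^ a × Ω₂ ^ b` of `∏ i, ∏ j, f (x i, y j)`, raised to the
power `1 / (a * b)`. -/
noncomputable def bicliqueNorm {Ω₁ Ω₂ : Type*} [MeasurableSpace Ω₁] [MeasurableSpace Ω₂]
    (μ : Measure Ω₁) (ν : Measure Ω₂) (a b : ℕ) (f : Ω₁ × Ω₂ → ℝ≥0) : ℝ≥0∞ :=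
  (∫⁻ p : (Fin a → Ω₁) × (Fin b → Ω₂), ∏ i : Fin a, ∏ j : Fin b, (f (p.1 i, p.2 j) : ℝ≥0∞)
    ∂((Measure.pi fun _ => μ).prod (Measure.pi fun _ => ν))) ^ (1 / ((a : ℝ) * (b : ℝ)))

/-- The product `∏_{uv ∈ E} F u v` over the (unordered) edges of a graph. Each edge is read off
with some ordering of its two ends; `edgeProd_eq` below shows that the ordering is immaterial
when `F u v = F v u` for every edge `uv`, the only case in which this is used. -/
noncomputable def edgeProd {V : Type*} (G : SimpleGraph V) [Fintype G.edgeSet]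
    (F : V → V → ℝ≥0∞) : ℝ≥0∞ :=
  ∏ e ∈ G.edgeFinset, F (Quot.out e).1 (Quot.out e).2

theorem edgeProd_eq {V : Type*} (G : SimpleGraph V) [Fintype G.edgeSet]
    (F : V → V → ℝ≥0∞) (hF : ∀ u v, G.Adj u v → F u v = F v u)
    (o : Sym2 V → V × V) (ho : ∀ e ∈ G.edgeSet, s((o e).1, (o e).2) = e) :
    edgeProd G F = ∏ e ∈ G.edgeFinset, F (o e).1 (o e).2 := by
  unfold edgeProd
  refine Finset.prod_congr rfl fun e he => ?_
  rw [SimpleGraph.mem_edgeFinset] at he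
  have h1 : s((Quot.out e).1, (Quot.out e).2) = e := Quot.out_eq e
  have h2 := ho e he
  have hadj : G.Adj (Quot.out e).1 (Quot.out e).2 := by
    rw [← SimpleGraph.mem_edgeSet, h1]; exact he
  rcases Sym2.eq_iff.mp (h1.trans h2.symm) with ⟨h, h'⟩ | ⟨h, h'⟩
  · rw [h, h']
  · rw [hF _ _ hadj, h, h']

/-- `‖f_{uv}‖_{K_{a,b}} = ‖f_{vu}‖_{K_{b,a}}`, so the right-hand side of the inequality does not
depend on how the ends of an edge are ordered. -/
theorem bicliqueNorm_swap {Ω₁ Ω₂ : Type*} [MeasurableSpace Ω₁] [MeasurableSpace Ω₂]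
    (μ : Measure Ω₁) (ν : Measure Ω₂) [SigmaFinite μ] [SigmaFinite ν] (a b : ℕ)
    (f : Ω₁ × Ω₂ → ℝ≥0) (g : Ω₂ × Ω₁ → ℝ≥0) (h : ∀ x y, f (x, y) = g (y, x)) :
    bicliqueNorm μ ν a b f = bicliqueNorm ν μ b a g := by
  unfold bicliqueNorm
  rw [← lintegral_prod_swap, mul_comm (a : ℝ)]
  congr 2
  funext p
  simp only [Prod.fst_swap, Prod.snd_swap, h]
  exact Finset.prod_comm

/-! Induction on the number of non-isolated vertices, removing a vertex `w` of maximum degree. Fix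
`x_w = z`. For each neighbour `u` of `w`, distribute `f_{wu}(z, ·)` equally over the `d_u - 1` other
edges at `u`, each receiving its power `1 / (d_u - 1)`; if `u` is a leaf, integrate `x_u` out
directly. The induction hypothesis for `G - w` then leaves a product of norms to be integrated over
`z`.

Since `N(w)` is independent, each remaining edge has at most one end in `N(w)`; edges with none do
not depend on `z` and keep their degrees. Hölder over the `d_w` neighbours `u`, then over the `d_u -
1` edges `uv`, reduces everything to one edge pair `wu`, `uv`. With `a = d_v`, `b = d_u - 1`, `c =
d_w`, what is needed is `∫ ‖f · g(z, ·)^(1/b)‖_{K_{a,b}}^(cb) dz ≤ ‖f‖_{K_{a,b+1}}^(cb)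
‖g‖_{K_{b+1,c}}^c`, which is `lintegral_ebicliqueNorm_pow_le`. It follows from `L^(c/a)` duality and
two uses of Hölder, and requires `a ≤ c`: hence the choice of `w`. -/

/-! ### Biclique integrals and the two-edge inequality -/

section BicliqueIntegral

variable {X Y Z : Type*} [MeasurableSpace X] [MeasurableSpace Y] [MeasurableSpace Z]

/-- Tonelli's theorem for the `n`-th tensor power of a function. -/
theorem lintegral_pi_fin_prod_eq_pow (μ : Measure X) [SigmaFinite μ] {φ : X → ℝ≥0∞}
    (hφ : Measurable φ) (n : ℕ) :
    ∫⁻ x : Fin n → X, ∏ i, φ (x i) ∂(Measure.pi fun _ => μ) = (∫⁻ x, φ x ∂μ) ^ n := by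
  induction n with
  | zero => simp
  | succ n ih =>
    rw [← ((measurePreserving_piFinSuccAbove (fun _ : Fin (n + 1) => μ) 0).symm).lintegral_comp_emb
      (MeasurableEquiv.measurableEmbedding _)]
    simp_rw [MeasurableEquiv.piFinSuccAbove_symm_apply, Fin.insertNthEquiv, Fin.prod_univ_succ,
      Equiv.coe_fn_mk, Fin.insertNth_zero, Fin.cons_succ, Fin.cons_zero]
    change ∫⁻ p : X × (Fin n → X), φ p.1 * ∏ i, φ (p.2 i) ∂(μ.prod (Measure.pi fun _ => μ)) = _
    rw [lintegral_prod_mul (g := fun x : Fin n → X => ∏ i, φ (x i)) hφ.aemeasurable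
      (Measurable.aemeasurable (by fun_prop)), ih, pow_succ']

/-- The integral of `∏ i, ∏ j, f (x i, y j)` over `X ^ a × Y ^ b`, with the variables in `Y`
integrated first. -/
noncomputable def bicliqueIntegral (μ : Measure X) (ν : Measure Y) (a b : ℕ)
    (f : X × Y → ℝ≥0∞) : ℝ≥0∞ :=
  ∫⁻ x : Fin a → X, (∫⁻ y, ∏ i, f (x i, y) ∂ν) ^ b ∂(Measure.pi fun _ => μ)

variable (μ : Measure X) (ν : Measure Y)

theorem bicliqueIntegral_eq_prod [SigmaFinite ν] (a b : ℕ) {f : X × Y → ℝ≥0∞} (hf : Measurable f) :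
    bicliqueIntegral μ ν a b f =
      ∫⁻ p : (Fin a → X) × (Fin b → Y), ∏ i, ∏ j, f (p.1 i, p.2 j)
        ∂((Measure.pi fun _ => μ).prod (Measure.pi fun _ => ν)) := by
  rw [lintegral_prod _ (by fun_prop)]
  refine lintegral_congr fun x => ?_
  rw [← lintegral_pi_fin_prod_eq_pow ν (by fun_prop) b]
  exact lintegral_congr fun y => Finset.prod_comm

theorem bicliqueIntegral_swap [SigmaFinite μ] [SigmaFinite ν] (a b : ℕ) {f : X × Y → ℝ≥0∞} (hf : Measurable f) :
    bicliqueIntegral μ ν a b f = bicliqueIntegral ν μ b a (fun p => f p.swap) := by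
  rw [bicliqueIntegral_eq_prod μ ν a b hf, bicliqueIntegral_eq_prod ν μ b a (by fun_prop),
    ← lintegral_prod_swap]
  exact lintegral_congr fun p => Finset.prod_comm

/-- If `I` pairs with every `G ^ (1 - 1 / t)` to at most `K * (∫ G) ^ (1 - 1 / t)`, then the
`L ^ t` norm of `I` is at most `K`. -/
theorem lintegral_rpow_le_of_pairing_le (κ : Measure Z) [SigmaFinite κ] {I : Z → ℝ≥0∞}
    {K : ℝ≥0∞} {t : ℝ} (ht : 1 ≤ t)
    (h : ∀ G : Z → ℝ≥0∞, Measurable G →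
      ∫⁻ z, G z ^ (1 - 1 / t) * I z ∂κ ≤ K * (∫⁻ z, G z ∂κ) ^ (1 - 1 / t)) :
    ∫⁻ z, I z ^ t ∂κ ≤ K ^ t := by
  have ht0 : 0 < t := by linarith
  have ht1 : 1 / t ≤ 1 := by rw [div_le_one ht0]; exact ht
  refine le_of_forall_lt fun L hL => ?_
  rw [lintegral_eq_nnreal] at hL
  simp only [lt_iSup_iff] at hL
  obtain ⟨g₀, hg₀, hL⟩ := hL
  rw [← SimpleFunc.lintegral_eq_lintegral] at hL
  -- σ-finiteness gives a simple minorant of `I ^ t` with finite integral still above `L`. Testing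
  -- against it needs no measurability of `I`, and finiteness permits the division below.
  obtain ⟨g, hg, hgt, hLg⟩ :=
    SimpleFunc.exists_lt_lintegral_simpleFunc_of_lt_lintegral (f := g₀) (by simpa using hL)
  set s := ∫⁻ z, (g z : ℝ≥0∞) ∂κ with hs
  have hs0 : s ≠ 0 := (bot_le.trans_lt hLg).ne'
  refine hLg.trans_le ?_
  have hpt : ∀ z, (g z : ℝ≥0∞) ≤ (g z : ℝ≥0∞) ^ (1 - 1 / t) * I z := by
    intro z
    have h1 : (g z : ℝ≥0∞) ^ (1 / t) ≤ I z := by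
      rw [one_div, ENNReal.rpow_inv_le_iff ht0]
      exact (ENNReal.coe_le_coe.2 (hg z)).trans (hg₀ z)
    calc (g z : ℝ≥0∞) = (g z : ℝ≥0∞) ^ (1 - 1 / t) * (g z : ℝ≥0∞) ^ (1 / t) := by
          rw [← ENNReal.rpow_add_of_nonneg _ _ (by linarith) (by positivity)]; simp
      _ ≤ _ := by gcongr
  have h2 : s ≤ K * s ^ (1 - 1 / t) :=
    (lintegral_mono hpt).trans (h (fun z => g z) (by fun_prop))
  have h3 : s ^ (1 / t) ≤ K := by
    have hp0 : s ^ (1 - 1 / t) ≠ 0 := by simp [ENNReal.rpow_eq_zero_iff, hs0, hgt.ne]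
    have hpt : s ^ (1 - 1 / t) ≠ ∞ := ENNReal.rpow_ne_top_of_nonneg (by linarith) hgt.ne
    rw [← ENNReal.mul_le_mul_iff_left hp0 hpt,
      ← ENNReal.rpow_add_of_nonneg _ _ (by positivity) (by linarith)]
    simpa using h2
  rwa [one_div, ENNReal.rpow_inv_le_iff ht0] at h3

/-- The inner biclique integral is `∫ Φ(x)^b ∏ g(z, x_i) dx`. By duality in `z` with exponent `t = c
/ a ≥ 1`, pair it with `G^(1 - 1/t)` and integrate over `z` first. Hölder with exponents `(b+1)/b`
and `b+1` splits `Φ^b` from the resulting function `R`. -/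
theorem lintegral_bicliqueIntegral_rpow_le [SigmaFinite μ] [SigmaFinite ν]
    (κ : Measure Z) [SigmaFinite κ] {a b c : ℕ}
    (ha : 0 < a) (hb : 0 < b) (hac : a ≤ c) {f : X × Y → ℝ≥0∞} (hf : Measurable f)
    {g : Z × X → ℝ≥0∞} (hg : Measurable g) :
    ∫⁻ z, bicliqueIntegral μ ν a b (fun p => f p * g (z, p.1) ^ (1 / (b : ℝ))) ^ ((c : ℝ) / a) ∂κ
      ≤ bicliqueIntegral μ ν a (b + 1) f ^ ((b : ℝ) / (b + 1) * ((c : ℝ) / a)) *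
        bicliqueIntegral κ μ (b + 1) c g ^ (1 / ((b : ℝ) + 1)) := by
  have ha' : (0 : ℝ) < a := by exact_mod_cast ha
  have hb' : (0 : ℝ) < b := by exact_mod_cast hb
  have hc' : (0 : ℝ) < c := by exact_mod_cast ha.trans_le hac
  have hac' : (a : ℝ) ≤ c := by exact_mod_cast hac
  set Φ : (Fin a → X) → ℝ≥0∞ := fun x => ∫⁻ y, ∏ i, f (x i, y) ∂ν with hΦ
  have hΦm : Measurable Φ := by
    apply Measurable.lintegral_prod_right'
      (f := fun p : (Fin a → X) × Y => ∏ i, f (p.1 i, p.2))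
    fun_prop
  have hI : ∀ z, bicliqueIntegral μ ν a b (fun p => f p * g (z, p.1) ^ (1 / (b : ℝ))) =
      ∫⁻ x, Φ x ^ b * ∏ i, g (z, x i) ∂(Measure.pi fun _ => μ) := by
    intro z
    refine lintegral_congr fun x => ?_
    simp only [Finset.prod_mul_distrib]
    rw [lintegral_mul_const _ (by fun_prop), mul_pow, ← Finset.prod_pow]
    congr 2
    funext i
    rw [← ENNReal.rpow_mul_natCast]
    field_simp
    simp
  set t : ℝ := (c : ℝ) / a with ht
  have ht1 : 1 ≤ t := by rw [ht, one_le_div ha']; exact hac'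
  have ht0 : 0 < t := by linarith
  have hti : 1 / t ≤ 1 := by rw [div_le_one ht0]; exact ht1
  set J := bicliqueIntegral κ μ (b + 1) c g
  have key : ∀ G : Z → ℝ≥0∞, Measurable G →
      ∫⁻ z, G z ^ (1 - 1 / t) *
          bicliqueIntegral μ ν a b (fun p => f p * g (z, p.1) ^ (1 / (b : ℝ))) ∂κ ≤
        (bicliqueIntegral μ ν a (b + 1) f ^ ((b : ℝ) / (b + 1)) *
          (J ^ (1 / t)) ^ (1 / ((b : ℝ) + 1))) * (∫⁻ z, G z ∂κ) ^ (1 - 1 / t) := by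
    intro G hG
    set R : (Fin a → X) → ℝ≥0∞ := fun x => ∫⁻ z, G z ^ (1 - 1 / t) * ∏ i, g (z, x i) ∂κ
    have hRm : Measurable R := by
      apply Measurable.lintegral_prod_right'
        (f := fun p : (Fin a → X) × Z => G p.2 ^ (1 - 1 / t) * ∏ i, g (p.2, p.1 i))
      fun_prop
    have hRb : ∫⁻ x, R x ^ (b + 1) ∂(Measure.pi fun _ => μ) ≤
        ((∫⁻ z, G z ∂κ) ^ (b + 1)) ^ (1 - 1 / t) * J ^ (1 / t) := by
      -- The weight `G^(1 - 1/t)` is spread evenly over the `a` factors, so that `∫ R^(b+1)` becomes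
      -- a biclique integral whose sides can be swapped. Hölder over `Z^(b+1)` then separates `G`,
      -- and the exponent `t = c / a` turns the power `a` of the inner integral into `c`.
      have e1 : ∫⁻ x, R x ^ (b + 1) ∂(Measure.pi fun _ => μ) =
          bicliqueIntegral μ κ a (b + 1)
            (fun p => g p.swap * (G p.2 ^ (1 - 1 / t)) ^ (1 / (a : ℝ))) := by
        refine lintegral_congr fun x => ?_
        congr 1
        refine lintegral_congr fun z => ?_
        simp only [Finset.prod_mul_distrib, Prod.swap, Finset.prod_const, Finset.card_univ,
          Fintype.card_fin]
        rw [mul_comm, ← ENNReal.rpow_mul_natCast (_ ^ _), one_div_mul_cancel ha'.ne',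
          ENNReal.rpow_one]
      rw [e1, bicliqueIntegral_swap _ _ _ _ (by fun_prop), ← lintegral_pi_fin_prod_eq_pow κ hG]
      refine le_trans (le_of_eq ?_) (ENNReal.lintegral_mul_norm_pow_le
        (Measurable.aemeasurable (by fun_prop))
        (Measurable.aemeasurable ?_) (by linarith) (by positivity) (by ring))
      · refine lintegral_congr fun z => ?_
        simp only [Prod.swap, Finset.prod_mul_distrib]
        rw [lintegral_mul_const _ (by fun_prop), mul_pow, mul_comm]
        congr 1
        · rw [← Finset.prod_pow, ← ENNReal.prod_rpow_of_nonneg (r := 1 - 1 / t) (by linarith)]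
          refine Finset.prod_congr rfl fun j _ => ?_
          rw [← ENNReal.rpow_mul_natCast (_ ^ _), one_div_mul_cancel ha'.ne', ENNReal.rpow_one]
        · rw [← ENNReal.rpow_natCast_mul, ht, ← ENNReal.rpow_natCast]
          congr 1
          field_simp
      · apply Measurable.pow_const
        apply Measurable.lintegral_prod_right'
          (f := fun p : (Fin (b + 1) → Z) × X => ∏ i, g (p.1 i, p.2))
        fun_prop
    calc ∫⁻ z, G z ^ (1 - 1 / t) *
          bicliqueIntegral μ ν a b (fun p => f p * g (z, p.1) ^ (1 / (b : ℝ))) ∂κ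
        = ∫⁻ x, Φ x ^ b * R x ∂(Measure.pi fun _ => μ) := by
          simp_rw [hI]
          rw [lintegral_congr fun z => (lintegral_const_mul _ (by fun_prop)).symm,
            lintegral_lintegral_swap (by fun_prop)]
          refine lintegral_congr fun x => ?_
          rw [← lintegral_const_mul _ (by fun_prop)]
          exact lintegral_congr fun z => by ring
      _ = ∫⁻ x, (Φ x ^ (b + 1)) ^ ((b : ℝ) / (b + 1)) *
            (R x ^ (b + 1)) ^ (1 / ((b : ℝ) + 1)) ∂(Measure.pi fun _ => μ) := by
          refine lintegral_congr fun x => ?_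
          rw [← ENNReal.rpow_natCast_mul, ← ENNReal.rpow_natCast_mul, ← ENNReal.rpow_natCast]
          push_cast
          rw [mul_div_cancel₀ _ (by positivity), mul_one_div_cancel (by positivity),
            ENNReal.rpow_one]
      _ ≤ (∫⁻ x, Φ x ^ (b + 1) ∂(Measure.pi fun _ => μ)) ^ ((b : ℝ) / (b + 1)) *
            (∫⁻ x, R x ^ (b + 1) ∂(Measure.pi fun _ => μ)) ^ (1 / ((b : ℝ) + 1)) :=
          ENNReal.lintegral_mul_norm_pow_le (by fun_prop) (by fun_prop) (by positivity) (by positivity)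
            (by field_simp)
      _ ≤ (∫⁻ x, Φ x ^ (b + 1) ∂(Measure.pi fun _ => μ)) ^ ((b : ℝ) / (b + 1)) *
            (((∫⁻ z, G z ∂κ) ^ (b + 1)) ^ (1 - 1 / t) * J ^ (1 / t)) ^ (1 / ((b : ℝ) + 1)) := by
          gcongr
      _ = _ := by
          rw [ENNReal.mul_rpow_of_nonneg _ _ (by positivity), ← ENNReal.rpow_natCast_mul,
            ← ENNReal.rpow_mul, mul_assoc, mul_comm (_ ^ _) ((J ^ _) ^ _)]
          have e : ((b + 1 : ℕ) : ℝ) * ((1 - 1 / t) * (1 / ((b : ℝ) + 1))) = 1 - 1 / t := by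
            push_cast
            field_simp
          rw [e, ← mul_assoc]
          rfl
  refine (lintegral_rpow_le_of_pairing_le κ ht1 key).trans (le_of_eq ?_)
  rw [ENNReal.mul_rpow_of_nonneg _ _ ht0.le, ← ENNReal.rpow_mul, ← ENNReal.rpow_mul,
    ← ENNReal.rpow_mul]
  congr 2
  field_simp

/-- The quantity `‖f‖_{K_{a,b}}` of a function with values in `[0, ∞]`. -/
noncomputable def ebicliqueNorm (a b : ℕ) (f : X × Y → ℝ≥0∞) : ℝ≥0∞ :=
  bicliqueIntegral μ ν a b f ^ (1 / ((a : ℝ) * (b : ℝ)))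

theorem bicliqueNorm_eq_ebicliqueNorm [SigmaFinite ν] (a b : ℕ) {f : X × Y → ℝ≥0}
    (hf : Measurable f) : bicliqueNorm μ ν a b f = ebicliqueNorm μ ν a b (fun p => f p) := by
  rw [bicliqueNorm, ebicliqueNorm, bicliqueIntegral_eq_prod _ _ _ _ (by fun_prop)]

theorem ebicliqueNorm_swap [SigmaFinite μ] [SigmaFinite ν] (a b : ℕ) {f : X × Y → ℝ≥0∞}
    (hf : Measurable f) : ebicliqueNorm μ ν a b f = ebicliqueNorm ν μ b a (fun p => f p.swap) := by
  rw [ebicliqueNorm, ebicliqueNorm, bicliqueIntegral_swap _ _ _ _ hf, mul_comm (a : ℝ)]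

theorem measurable_ebicliqueNorm_param [SigmaFinite μ] [SigmaFinite ν] (a b : ℕ)
    {F : Z → X × Y → ℝ≥0∞} (hF : Measurable (Function.uncurry F)) :
    Measurable fun z => ebicliqueNorm μ ν a b (F z) := by
  apply Measurable.pow_const
  apply Measurable.lintegral_prod_right'
    (f := fun p : Z × (Fin a → X) => (∫⁻ y, ∏ i, F p.1 (p.2 i, y) ∂ν) ^ b)
  apply Measurable.pow_const
  apply Measurable.lintegral_prod_right'
    (f := fun p : (Z × (Fin a → X)) × Y => ∏ i, F p.1.1 (p.1.2 i, p.2))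
  have : ∀ i, Measurable fun p : (Z × (Fin a → X)) × Y => F p.1.1 (p.1.2 i, p.2) := fun i =>
    hF.comp (g := Function.uncurry F) (f := fun p : (Z × (Fin a → X)) × Y =>
      (p.1.1, (p.1.2 i, p.2))) (by fun_prop)
  fun_prop

/-- The previous estimate in terms of norms: the power `c * b` of the norm is the power `c / a` of
the integral. -/
theorem lintegral_ebicliqueNorm_pow_le [SigmaFinite μ] [SigmaFinite ν]
    (κ : Measure Z) [SigmaFinite κ] {a b c : ℕ}
    (ha : 0 < a) (hb : 0 < b) (hac : a ≤ c) {f : X × Y → ℝ≥0∞} (hf : Measurable f)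
    {g : Z × X → ℝ≥0∞} (hg : Measurable g) :
    ∫⁻ z, ebicliqueNorm μ ν a b (fun p => f p * g (z, p.1) ^ (1 / (b : ℝ))) ^ (c * b) ∂κ
      ≤ ebicliqueNorm μ ν a (b + 1) f ^ (c * b) * ebicliqueNorm κ μ (b + 1) c g ^ c := by
  have ha' : (0 : ℝ) < a := by exact_mod_cast ha
  have hb' : (0 : ℝ) < b := by exact_mod_cast hb
  have hc' : (0 : ℝ) < c := by exact_mod_cast ha.trans_le hac
  convert lintegral_bicliqueIntegral_rpow_le μ ν κ ha hb hac hf hg using 1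
  · refine lintegral_congr fun z => ?_
    rw [ebicliqueNorm, ← ENNReal.rpow_mul_natCast]
    congr 1
    push_cast
    field_simp
  · rw [ebicliqueNorm, ebicliqueNorm, ← ENNReal.rpow_mul_natCast, ← ENNReal.rpow_mul_natCast]
    congr 2 <;> push_cast <;> field_simp

/-- Hölder's inequality for a product of `n` functions with equal exponents. -/
theorem lintegral_finset_prod_pow_le {ι : Type*} (s : Finset ι) {T : ι → X → ℝ≥0∞}
    (hT : ∀ i, Measurable (T i)) {n : ℕ} (hn : s.card = n) (hn0 : 0 < n) :
    ∫⁻ x, ∏ i ∈ s, T i x ∂μ ≤ ∏ i ∈ s, (∫⁻ x, T i x ^ n ∂μ) ^ (1 / (n : ℝ)) := by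
  have hn' : (0 : ℝ) < n := by exact_mod_cast hn0
  refine le_trans (le_of_eq ?_) (ENNReal.lintegral_prod_norm_pow_le s
    (f := fun i x => T i x ^ n) (p := fun _ => 1 / (n : ℝ)) (fun i _ => by fun_prop)
    (by simp [hn, hn'.ne']) (fun _ _ => by positivity))
  refine lintegral_congr fun x => Finset.prod_congr rfl fun i _ => ?_
  rw [← ENNReal.rpow_natCast_mul, mul_one_div_cancel hn'.ne', ENNReal.rpow_one]

end BicliqueIntegral

/-! ### Products over edges -/

section EdgeProd

variable {V : Type*}

theorem edgeProd_congr (G : SimpleGraph V) [Fintype G.edgeSet] {F F' : V → V → ℝ≥0∞} (h : ∀ u v, G.Adj u v → F u v = F' u v) :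
    edgeProd G F = edgeProd G F' := by
  refine Finset.prod_congr rfl fun e he => h _ _ ?_
  rw [← SimpleGraph.mem_edgeSet]
  have h1 : s((Quot.out e).1, (Quot.out e).2) = e := Quot.out_eq e
  rw [h1]
  exact SimpleGraph.mem_edgeFinset.1 he

theorem symm_out_mk {F : V → V → ℝ≥0∞} (hF : ∀ u v, F u v = F v u) (u v : V) :
    F (Quot.out s(u, v)).1 (Quot.out s(u, v)).2 = F u v := by
  have h1 : s((Quot.out s(u, v)).1, (Quot.out s(u, v)).2) = s(u, v) := Quot.out_eq _
  rcases Sym2.eq_iff.mp h1 with ⟨h, h'⟩ | ⟨h, h'⟩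
  · rw [h, h']
  · rw [h, h', hF]

/-- The graph `G` with all edges that meet `A` removed. -/
def removeVerts (G : SimpleGraph V) (A : Finset V) : SimpleGraph V where
  Adj u v := G.Adj u v ∧ u ∉ A ∧ v ∉ A
  symm := ⟨fun _ _ h => ⟨h.1.symm, h.2.2, h.2.1⟩⟩
  loopless := ⟨fun _ h => h.1.ne rfl⟩

theorem removeVerts_adj {G : SimpleGraph V} {A : Finset V} {u v : V} :
    (removeVerts G A).Adj u v ↔ G.Adj u v ∧ u ∉ A ∧ v ∉ A := Iff.rfl

variable [Fintype V] [DecidableEq V] (G : SimpleGraph V) [DecidableRel G.Adj]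

theorem prod_mem_mk {M : Type*} [CommMonoid M] (H : V → M) (u v : V) (huv : u ≠ v) :
    ∏ x with x ∈ s(u, v), H x = H u * H v := by
  have : (Finset.univ.filter fun x => x ∈ s(u, v)) = {u, v} := by ext x; simp
  rw [this, Finset.prod_pair huv]

/-- Vertex factors can be moved from the edges to the vertices. -/
theorem edgeProd_mul_vertex (F : V → V → ℝ≥0∞) (H : V → ℝ≥0∞) :
    edgeProd G (fun u v => F u v * H u * H v) = edgeProd G F * ∏ u, H u ^ G.degree u := by
  simp only [edgeProd, mul_assoc]
  rw [Finset.prod_mul_distrib]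
  congr 1
  have h1 : ∀ e ∈ G.edgeFinset, H (Quot.out e).1 * H (Quot.out e).2 = ∏ x with x ∈ e, H x := by
    intro e he
    have h1 : s((Quot.out e).1, (Quot.out e).2) = e := Quot.out_eq e
    have hadj : G.Adj (Quot.out e).1 (Quot.out e).2 := by
      rw [← SimpleGraph.mem_edgeSet, h1]; exact SimpleGraph.mem_edgeFinset.1 he
    rw [← prod_mem_mk H _ _ hadj.ne, h1]
  rw [Finset.prod_congr rfl h1]
  simp only [Finset.prod_filter]
  rw [Finset.prod_comm]
  refine Finset.prod_congr rfl fun u _ => ?_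
  rw [← Finset.prod_filter, Finset.prod_const, ← G.incidenceFinset_eq_filter,
    G.card_incidenceFinset_eq_degree]

instance (A : Finset V) : DecidableRel (removeVerts G A).Adj := fun u v =>
  inferInstanceAs (Decidable (G.Adj u v ∧ u ∉ A ∧ v ∉ A))

/-- The edges that meet an independent set can be listed by their end in that set. -/
theorem edgeProd_removeVerts {A : Finset V} (hA : ∀ u ∈ A, ∀ v ∈ A, ¬ G.Adj u v)
    {F : V → V → ℝ≥0∞} (hF : ∀ u v, F u v = F v u) :
    edgeProd G F = edgeProd (removeVerts G A) F * ∏ u ∈ A, ∏ v ∈ G.neighborFinset u, F u v := by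
  have hE : G.edgeFinset = (removeVerts G A).edgeFinset ∪
      A.biUnion fun u => (G.neighborFinset u).image fun v => s(u, v) := by
    ext e
    induction e with | _ x y
    simp only [SimpleGraph.mem_edgeFinset, SimpleGraph.mem_edgeSet, Finset.mem_union,
      Finset.mem_biUnion, Finset.mem_image, SimpleGraph.mem_neighborFinset, removeVerts_adj]
    constructor
    · intro h
      by_cases hx : x ∈ A
      · exact Or.inr ⟨x, hx, y, h, rfl⟩
      by_cases hy : y ∈ A
      · exact Or.inr ⟨y, hy, x, h.symm, Sym2.eq_swap⟩
      exact Or.inl ⟨h, hx, hy⟩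
    · rintro (h | ⟨u, hu, v, h, e⟩)
      · exact h.1
      · rcases Sym2.eq_iff.mp e with ⟨rfl, rfl⟩ | ⟨rfl, rfl⟩
        exacts [h, h.symm]
  rw [edgeProd, hE, Finset.prod_union]
  · congr 1
    rw [Finset.prod_biUnion]
    · refine Finset.prod_congr rfl fun u hu => ?_
      rw [Finset.prod_image fun v _ v' _ h => Sym2.congr_right.1 h]
      exact Finset.prod_congr rfl fun v _ => symm_out_mk hF u v
    · intro u hu u' hu' huu'
      simp only [Function.onFun, Finset.disjoint_left, Finset.mem_image,
        SimpleGraph.mem_neighborFinset]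
      rintro e ⟨v, hv, rfl⟩ ⟨v', hv', e⟩
      rcases Sym2.eq_iff.mp e with ⟨rfl, rfl⟩ | ⟨rfl, rfl⟩
      · exact huu' rfl
      · exact hA _ hu _ hu' hv
  · simp only [Finset.disjoint_left, Finset.mem_biUnion, Finset.mem_image, not_exists, not_and,
      SimpleGraph.mem_edgeFinset]
    rintro e he u hu v _ rfl
    exact he.2.1 hu

end EdgeProd

/-! ### Degrees after removing a vertex -/

section RemoveVertex

variable {V : Type*} [Fintype V] [DecidableEq V] (G : SimpleGraph V) [DecidableRel G.Adj]

theorem neighborFinset_removeVerts_singleton {u w : V} (h : u ≠ w) :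
    (removeVerts G {w}).neighborFinset u = (G.neighborFinset u).erase w := by
  ext v
  simp [removeVerts_adj, h, and_comm]

theorem degree_removeVerts_of_adj {u w : V} (h : G.Adj w u) :
    (removeVerts G {w}).degree u + 1 = G.degree u := by
  rw [← SimpleGraph.card_neighborFinset_eq_degree, ← SimpleGraph.card_neighborFinset_eq_degree,
    neighborFinset_removeVerts_singleton G h.ne']
  exact Finset.card_erase_add_one ((G.mem_neighborFinset _ _).2 h.symm)

theorem degree_removeVerts_of_not_adj {u w : V} (h : ¬ G.Adj w u) (huw : u ≠ w) :
    (removeVerts G {w}).degree u = G.degree u := by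
  rw [← SimpleGraph.card_neighborFinset_eq_degree, ← SimpleGraph.card_neighborFinset_eq_degree,
    neighborFinset_removeVerts_singleton G huw, Finset.erase_eq_of_notMem]
  rw [SimpleGraph.mem_neighborFinset]
  exact fun h' => h h'.symm

theorem degree_removeVerts_self (w : V) : (removeVerts G {w}).degree w = 0 := by
  rw [← SimpleGraph.card_neighborFinset_eq_degree, Finset.card_eq_zero]
  ext v
  simp [removeVerts_adj]

end RemoveVertex

/-! ### Partial integration -/

section Marginal

variable {V : Type*} [DecidableEq V] {Ω : V → Type*} [∀ v, MeasurableSpace (Ω v)]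
  {μ : ∀ v, Measure (Ω v)}

/-- A factor that does not depend on the variables in `s` can be moved out of the integral. -/
theorem lmarginal_const_mul {s : Finset V} {k g : (∀ v, Ω v) → ℝ≥0∞} (hg : Measurable g)
    (x : ∀ v, Ω v) (hk : ∀ y : ∀ v, Ω v, (∀ v ∉ s, y v = x v) → k y = k x) :
    (∫⋯∫⁻_s, (fun y => k y * g y) ∂μ) x = k x * (∫⋯∫⁻_s, g ∂μ) x := by
  have h : ∀ p : (∀ v : s, Ω v), k (Function.updateFinset x s p) = k x := fun p =>
    hk _ fun v hv => by simp [Function.updateFinset, hv]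
  simp only [lmarginal, h]
  exact lintegral_const_mul _ (hg.comp measurable_updateFinset)

theorem lmarginal_finset_prod [∀ v, SigmaFinite (μ v)] (s : Finset V) {h : ∀ v, Ω v → ℝ≥0∞}
    (hh : ∀ v, Measurable (h v)) (x : ∀ v, Ω v) :
    (∫⋯∫⁻_s, (fun y => ∏ v ∈ s, h v (y v)) ∂μ) x = ∏ v ∈ s, ∫⁻ t, h v t ∂(μ v) := by
  induction s using Finset.induction generalizing x with
  | empty => simp
  | insert i s hi ih =>
    rw [lmarginal_insert _ (by fun_prop) hi, Finset.prod_insert hi,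
      ← lintegral_mul_const _ (hh i)]
    refine lintegral_congr fun t => ?_
    simp only [Finset.prod_insert hi]
    rw [lmarginal_const_mul (k := fun y => h i (y i)) (by fun_prop), ih]
    · simp
    · intro y hy
      simp only [hy i hi]

end Marginal

/-! ### Absorbing the edges at a vertex -/

section Tilt

variable {V : Type*} [Fintype V] [DecidableEq V] (G : SimpleGraph V) [DecidableRel G.Adj]
  {Ω : V → Type*} [∀ v, MeasurableSpace (Ω v)]

/-- The factor by which each remaining edge at `u` absorbs `f w u (z, ·)` when the vertex `w` is
removed and its variable is fixed to `z`. -/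
noncomputable def absorbedFactor (f : ∀ u v : V, Ω u × Ω v → ℝ≥0∞) (w : V) (z : Ω w) (u : V)
    (t : Ω u) : ℝ≥0∞ :=
  if G.Adj w u then f w u (z, t) ^ (1 / ((removeVerts G {w}).degree u : ℝ)) else 1

/-- The edge functions of the graph without `w`, after the edges at `w` have been absorbed. -/
noncomputable def absorbedEdge (f : ∀ u v : V, Ω u × Ω v → ℝ≥0∞) (w : V) (z : Ω w) (u v : V)
    (p : Ω u × Ω v) : ℝ≥0∞ :=
  f u v p * absorbedFactor G f w z u p.1 * absorbedFactor G f w z v p.2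

variable {f : ∀ u v : V, Ω u × Ω v → ℝ≥0∞} {w : V}

theorem measurable_absorbedFactor (hf : ∀ u v, Measurable (f u v)) (u : V) :
    Measurable fun q : Ω w × Ω u => absorbedFactor G f w q.1 u q.2 := by
  unfold absorbedFactor
  split_ifs <;> fun_prop

theorem measurable_uncurry_absorbedEdge (hf : ∀ u v, Measurable (f u v)) (u v : V) :
    Measurable (Function.uncurry fun z : Ω w => absorbedEdge G f w z u v) := by
  have hu := (measurable_absorbedFactor G (w := w) hf u).comp
    (g := fun q : Ω w × Ω u => absorbedFactor G f w q.1 u q.2)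
    (f := fun q : Ω w × (Ω u × Ω v) => (q.1, q.2.1)) (by fun_prop)
  have hv := (measurable_absorbedFactor G (w := w) hf v).comp
    (g := fun q : Ω w × Ω v => absorbedFactor G f w q.1 v q.2)
    (f := fun q : Ω w × (Ω u × Ω v) => (q.1, q.2.2)) (by fun_prop)
  exact (((hf u v).comp measurable_snd).mul hu).mul hv

theorem measurable_absorbedEdge (hf : ∀ u v, Measurable (f u v)) (z : Ω w) (u v : V) :
    Measurable (absorbedEdge G f w z u v) :=
  (measurable_uncurry_absorbedEdge G hf u v).comp measurable_prodMk_left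

omit [∀ v, MeasurableSpace (Ω v)] in
theorem absorbedEdge_symm (hs : ∀ u v x y, f u v (x, y) = f v u (y, x)) (z : Ω w) (u v : V)
    (x : Ω u) (y : Ω v) : absorbedEdge G f w z u v (x, y) = absorbedEdge G f w z v u (y, x) := by
  simp only [absorbedEdge]
  rw [hs, mul_right_comm]

/-- The neighbours of `w` that have no other neighbour. -/
def leafNeighbors (w : V) : Finset V := {u ∈ G.neighborFinset w | G.degree u = 1}

omit [∀ v, MeasurableSpace (Ω v)] in
-- A non-leaf neighbour `u` has `d_u - 1` remaining edges, and their equal shares of `f w u`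
-- multiply back to `f w u`. Leaves have no edge to absorb it.
theorem edgeProd_eq_absorbed (hs : ∀ u v x y, f u v (x, y) = f v u (y, x)) (y : ∀ v, Ω v) :
    edgeProd G (fun u v => f u v (y u, y v)) =
      (∏ u ∈ leafNeighbors G w, f w u (y w, y u)) *
        edgeProd (removeVerts G {w}) (fun u v => absorbedEdge G f w (y w) u v (y u, y v)) := by
  have h1 := edgeProd_removeVerts G (A := {w}) (by simp)
    (F := fun u v => f u v (y u, y v)) (fun u v => hs u v _ _)
  rw [h1, Finset.prod_singleton]
  simp only [absorbedEdge]
  rw [edgeProd_mul_vertex (removeVerts G {w}) _ (fun u => absorbedFactor G f w (y w) u (y u)),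
    mul_left_comm]
  congr 1
  rw [leafNeighbors, Finset.prod_filter, ← Finset.prod_subset (Finset.subset_univ
    (G.neighborFinset w)), ← Finset.prod_mul_distrib]
  · refine Finset.prod_congr rfl fun u hu => ?_
    rw [SimpleGraph.mem_neighborFinset] at hu
    have hd := degree_removeVerts_of_adj G hu
    simp only [absorbedFactor, hu, if_true]
    rcases Nat.eq_zero_or_pos ((removeVerts G {w}).degree u) with h0 | h0
    · rw [if_pos (by omega), h0]
      simp
    · rw [if_neg (by omega), one_mul, ← ENNReal.rpow_mul_natCast, one_div_mul_cancel (by positivity),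
        ENNReal.rpow_one]
  · intro u _ hu
    rw [SimpleGraph.mem_neighborFinset] at hu
    simp [absorbedFactor, hu]

end Tilt

/-! ### The induction -/

section Induction

variable {V : Type*} [Fintype V] [DecidableEq V] (G : SimpleGraph V) [DecidableRel G.Adj]
  {Ω : V → Type*} [∀ v, MeasurableSpace (Ω v)] (μ : ∀ v, Measure (Ω v))
  {f : ∀ u v : V, Ω u × Ω v → ℝ≥0∞} {w : V}

/-- The norm `‖f_{uv}‖_{K_{d_v, d_u}}` with the degrees taken in `G`. -/
noncomputable def degreeNorm (f : ∀ u v : V, Ω u × Ω v → ℝ≥0∞) (u v : V) : ℝ≥0∞ :=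
  ebicliqueNorm (μ u) (μ v) (G.degree v) (G.degree u) (f u v)

variable [∀ v, SigmaFinite (μ v)]

omit [DecidableEq V] in
theorem degreeNorm_symm (hf : ∀ u v, Measurable (f u v))
    (hs : ∀ u v x y, f u v (x, y) = f v u (y, x)) (u v : V) :
    degreeNorm G μ f u v = degreeNorm G μ f v u := by
  rw [degreeNorm, ebicliqueNorm_swap _ _ _ _ (hf u v), degreeNorm]
  congr 1
  funext p
  exact hs _ _ _ _

/-- What remains at a neighbour `u` of `w` once all variables other than that of `w` have been
integrated. -/
noncomputable def neighborFactor (f : ∀ u v : V, Ω u × Ω v → ℝ≥0∞) (w : V) (u : V) (z : Ω w) :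
    ℝ≥0∞ :=
  (∏ v ∈ (removeVerts G {w}).neighborFinset u,
    degreeNorm (removeVerts G {w}) μ (absorbedEdge G f w z) u v) *
  if G.degree u = 1 then ∫⁻ t, f w u (z, t) ∂(μ u) else 1

theorem measurable_neighborFactor (hf : ∀ u v, Measurable (f u v)) (u : V) :
    Measurable (neighborFactor G μ f w u) := by
  refine Measurable.mul (Finset.measurable_prod _ fun v _ => ?_) ?_
  · exact measurable_ebicliqueNorm_param _ _ _ _ (measurable_uncurry_absorbedEdge G hf u v)
  · split_ifs
    · exact (hf w u).lintegral_prod_right'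
    · exact measurable_const

theorem ebicliqueNorm_one_pow {X Y : Type*} [MeasurableSpace X] [MeasurableSpace Y]
    (μ : Measure X) (ν : Measure Y) [SigmaFinite μ] [SigmaFinite ν] {c : ℕ} (hc : 0 < c)
    {g : X × Y → ℝ≥0∞} (hg : Measurable g) :
    ebicliqueNorm μ ν 1 c g ^ c = ∫⁻ x, (∫⁻ y, g (x, y) ∂ν) ^ c ∂μ := by
  have hc' : (c : ℝ) ≠ 0 := by positivity
  have h := lintegral_pi_fin_prod_eq_pow μ (φ := fun x => (∫⁻ y, g (x, y) ∂ν) ^ c)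
    (hg.lintegral_prod_right'.pow_const c) 1
  rw [pow_one] at h
  rw [← h, ebicliqueNorm, ← ENNReal.rpow_mul_natCast, Nat.cast_one, one_mul,
    one_div_mul_cancel hc', ENNReal.rpow_one]
  simp [bicliqueIntegral]

/-- For a leaf this is an equality, the norm being of type `K_{1, d_w}`. Otherwise Hölder over the
`b = d_u - 1` remaining edges at `u` reduces to the two-edge inequality for each of them. -/
theorem lintegral_neighborFactor_le (hG : ∀ u v x, G.Adj u v → G.Adj v x → ¬ G.Adj u x)
    (hf : ∀ u v, Measurable (f u v)) (hw : ∀ v, G.degree v ≤ G.degree w) {u : V}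
    (hu : G.Adj w u) :
    ∫⁻ z, neighborFactor G μ f w u z ^ G.degree w ∂(μ w) ≤
      ((∏ v ∈ (removeVerts G {w}).neighborFinset u, degreeNorm G μ f u v) *
        degreeNorm G μ f w u) ^ G.degree w := by
  have hd := degree_removeVerts_of_adj G hu
  have hc : 0 < G.degree w := (G.degree_pos_iff_exists_adj w).2 ⟨u, hu⟩
  set b := (removeVerts G {w}).degree u with hb
  rcases Nat.eq_zero_or_pos b with h0 | h0
  · have hN : (removeVerts G {w}).neighborFinset u = ∅ := by
      rw [← Finset.card_eq_zero, SimpleGraph.card_neighborFinset_eq_degree]; exact h0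
    have h1 : G.degree u = 1 := by omega
    simp only [neighborFactor, hN, h1, Finset.prod_empty, one_mul, if_true, degreeNorm]
    rw [ebicliqueNorm_one_pow _ _ hc (hf w u)]
  · have h1 : G.degree u ≠ 1 := by omega
    have hb' : (b : ℝ) ≠ 0 := by positivity
    have hcard : ((removeVerts G {w}).neighborFinset u).card = b := by
      rw [SimpleGraph.card_neighborFinset_eq_degree]
    simp only [neighborFactor, h1, if_false, mul_one, ← Finset.prod_pow]
    refine (lintegral_finset_prod_pow_le (μ w) _ (fun v => ?_) hcard h0).trans ?_
    · exact (measurable_ebicliqueNorm_param _ _ _ _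
        (measurable_uncurry_absorbedEdge G hf u v)).pow_const _
    rw [mul_pow, ← Finset.prod_pow]
    -- Each of the `b` edges contributes a `b`-th root of this power.
    have hpow : degreeNorm G μ f w u ^ G.degree w =
        ∏ v ∈ (removeVerts G {w}).neighborFinset u,
          (degreeNorm G μ f w u ^ G.degree w) ^ (1 / (b : ℝ)) := by
      rw [Finset.prod_const, hcard, ← ENNReal.rpow_mul_natCast, one_div_mul_cancel hb',
        ENNReal.rpow_one]
    rw [hpow, ← Finset.prod_mul_distrib]
    refine Finset.prod_le_prod' fun v hv => ?_
    rw [SimpleGraph.mem_neighborFinset, removeVerts_adj] at hv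
    have hvw : v ≠ w := by simpa using hv.2.2
    -- No triangle: `v` absorbs nothing and keeps its degree, so only `u` tilts the edge `uv`.
    have hwv : ¬ G.Adj w v := hG _ _ _ hu hv.1
    have hdv := degree_removeVerts_of_not_adj G hwv hvw
    have hv0 : 0 < G.degree v := (G.degree_pos_iff_exists_adj v).2 ⟨u, hv.1.symm⟩
    have hkey := lintegral_ebicliqueNorm_pow_le (μ u) (μ v) (μ w) hv0 h0 (hw v) (hf u v) (hf w u)
    have e : ∀ z, degreeNorm (removeVerts G {w}) μ (absorbedEdge G f w z) u v =
        ebicliqueNorm (μ u) (μ v) (G.degree v) b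
          (fun p => f u v p * f w u (z, p.1) ^ (1 / (b : ℝ))) := by
      intro z
      rw [degreeNorm, hdv]
      congr 1
      funext p
      simp [absorbedEdge, absorbedFactor, hu, hwv, hb]
    simp only [e, ← pow_mul]
    refine (ENNReal.rpow_le_rpow hkey (by positivity)).trans (le_of_eq ?_)
    rw [hd, ENNReal.mul_rpow_of_nonneg _ _ (by positivity), pow_mul, ← ENNReal.rpow_natCast_mul,
      mul_one_div_cancel hb', ENNReal.rpow_one, degreeNorm, degreeNorm]

/-- Isolates the dependence on `z`: edges avoiding `N(w)` are unchanged, and the others are grouped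
by their unique end in `N(w)`. -/
theorem prod_absorbedNorm_eq (hG : ∀ u v x, G.Adj u v → G.Adj v x → ¬ G.Adj u x)
    (hf : ∀ u v, Measurable (f u v)) (hs : ∀ u v x y, f u v (x, y) = f v u (y, x)) (z : Ω w) :
    (∏ u ∈ leafNeighbors G w, ∫⁻ t, f w u (z, t) ∂(μ u)) *
        edgeProd (removeVerts G {w})
          (degreeNorm (removeVerts G {w}) μ (absorbedEdge G f w z)) =
      edgeProd (removeVerts (removeVerts G {w}) (G.neighborFinset w)) (degreeNorm G μ f) *
        ∏ u ∈ G.neighborFinset w, neighborFactor G μ f w u z := by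
  rw [edgeProd_removeVerts (removeVerts G {w}) (A := G.neighborFinset w) _
    (degreeNorm_symm _ μ (measurable_absorbedEdge G hf z) (absorbedEdge_symm G hs z)),
    mul_left_comm]
  · congr 1
    · refine edgeProd_congr _ fun u v huv => ?_
      simp only [removeVerts_adj, Finset.mem_singleton, SimpleGraph.mem_neighborFinset] at huv
      obtain ⟨⟨-, huw, hvw⟩, hu, hv⟩ := huv
      rw [degreeNorm, degree_removeVerts_of_not_adj G hu huw,
        degree_removeVerts_of_not_adj G hv hvw, degreeNorm]
      congr 1
      funext p
      simp [absorbedEdge, absorbedFactor, hu, hv]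
    · simp only [neighborFactor, Finset.prod_mul_distrib]
      rw [leafNeighbors, Finset.prod_filter, mul_comm]
  · intro u hu v hv huv
    rw [SimpleGraph.mem_neighborFinset] at hu hv
    exact hG _ _ _ hu huv.1 hv

/-- Hölder with exponent `d_w` over the `d_w` neighbours of `w`, then the bound for each neighbour.
-/
theorem lintegral_prod_absorbedNorm_le (hG : ∀ u v x, G.Adj u v → G.Adj v x → ¬ G.Adj u x)
    (hf : ∀ u v, Measurable (f u v)) (hs : ∀ u v x y, f u v (x, y) = f v u (y, x))
    (hw : ∀ v, G.degree v ≤ G.degree w) (hw0 : 0 < G.degree w) :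
    ∫⁻ z, (∏ u ∈ leafNeighbors G w, ∫⁻ t, f w u (z, t) ∂(μ u)) *
        edgeProd (removeVerts G {w})
          (degreeNorm (removeVerts G {w}) μ (absorbedEdge G f w z)) ∂(μ w) ≤
      edgeProd G (degreeNorm G μ f) := by
  have hN := degreeNorm_symm G μ hf hs
  have hc : (G.degree w : ℝ) ≠ 0 := by positivity
  simp only [prod_absorbedNorm_eq G μ hG hf hs]
  rw [lintegral_const_mul _ (Finset.measurable_prod _ fun u _ => measurable_neighborFactor G μ hf u),
    edgeProd_removeVerts G (A := {w}) (by simp) hN,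
    edgeProd_removeVerts (removeVerts G {w}) (A := G.neighborFinset w) _ hN,
    Finset.prod_singleton, mul_assoc, ← Finset.prod_mul_distrib]
  · gcongr
    refine (lintegral_finset_prod_pow_le (μ w) _ (measurable_neighborFactor G μ hf)
      (G.card_neighborFinset_eq_degree w) hw0).trans ?_
    refine Finset.prod_le_prod' fun u hu => ?_
    rw [SimpleGraph.mem_neighborFinset] at hu
    refine (ENNReal.rpow_le_rpow (lintegral_neighborFactor_le G μ hG hf hw hu)
      (by positivity)).trans (le_of_eq ?_)
    rw [← ENNReal.rpow_natCast_mul, mul_one_div_cancel hc, ENNReal.rpow_one]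
  · intro u hu v hv huv
    rw [SimpleGraph.mem_neighborFinset] at hu hv
    exact hG _ _ _ hu huv.1 hv

/-- The vertices of `G` that are not isolated. -/
def nonIsolated : Finset V := {v | 0 < G.degree v}

theorem nonIsolated_eq (hw0 : 0 < G.degree w) :
    nonIsolated G = insert w (leafNeighbors G w ∪ nonIsolated (removeVerts G {w})) := by
  ext u
  simp only [nonIsolated, leafNeighbors, Finset.mem_filter, Finset.mem_univ, true_and,
    Finset.mem_insert, Finset.mem_union, SimpleGraph.mem_neighborFinset]
  by_cases huw : u = w
  · subst huw; simp [hw0]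
  by_cases hu : G.Adj w u
  · have := degree_removeVerts_of_adj G hu
    simp only [huw, hu, true_and, false_or]
    omega
  · simp [huw, hu, degree_removeVerts_of_not_adj G hu huw]

theorem notMem_nonIsolated_removeVerts : w ∉ nonIsolated (removeVerts G {w}) := by
  simp [nonIsolated, degree_removeVerts_self]

omit [DecidableEq V] in
theorem notMem_leafNeighbors : w ∉ leafNeighbors G w := by
  simp [leafNeighbors]

theorem disjoint_leafNeighbors :
    Disjoint (leafNeighbors G w) (nonIsolated (removeVerts G {w})) := by
  rw [Finset.disjoint_left]
  intro u hu hu'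
  simp only [nonIsolated, leafNeighbors, Finset.mem_filter, Finset.mem_univ, true_and,
    SimpleGraph.mem_neighborFinset] at hu hu'
  have := degree_removeVerts_of_adj G hu.1
  omega

omit [DecidableEq V] in
theorem measurable_edgeProd {Z : Type*} [MeasurableSpace Z]
    {F : V → V → Z → ℝ≥0∞} (hF : ∀ u v, Measurable (F u v)) :
    Measurable fun x => edgeProd G (fun u v => F u v x) :=
  Finset.measurable_prod _ fun _ _ => hF _ _

/-- Only non-isolated vertices are integrated, so `V` and the spaces stay fixed while edges are
removed. Arbitrary `[0, ∞]`-valued `f` are allowed because the absorbed edge functions must again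
qualify. -/
theorem lmarginal_edgeProd_le (n : ℕ) (G : SimpleGraph V) [DecidableRel G.Adj]
    (hG : ∀ u v x, G.Adj u v → G.Adj v x → ¬ G.Adj u x) (hn : (nonIsolated G).card = n)
    (f : ∀ u v : V, Ω u × Ω v → ℝ≥0∞)
    (hf : ∀ u v, Measurable (f u v)) (hs : ∀ u v x y, f u v (x, y) = f v u (y, x))
    (x : ∀ v, Ω v) :
    (∫⋯∫⁻_nonIsolated G, (fun x => edgeProd G (fun u v => f u v (x u, x v))) ∂μ) x ≤
      edgeProd G (degreeNorm G μ f) := by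
  induction n using Nat.strong_induction_on generalizing G f x with
  | _ n ih =>
  rcases (nonIsolated G).eq_empty_or_nonempty with hemp | ⟨v₀, hv₀⟩
  · have hE : G.edgeFinset = ∅ := by
      rw [Finset.eq_empty_iff_forall_notMem]
      intro e he
      induction e with | _ u v
      have : u ∈ nonIsolated G := by
        simp only [nonIsolated, Finset.mem_filter, Finset.mem_univ, true_and]
        exact (G.degree_pos_iff_exists_adj u).2 ⟨v, SimpleGraph.mem_edgeFinset.1 he⟩
      simp [hemp] at this
    simp [hemp, edgeProd, hE]
  obtain ⟨w, -, hw⟩ := Finset.exists_max_image Finset.univ (fun v => G.degree v) ⟨v₀, by simp⟩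
  replace hw : ∀ v, G.degree v ≤ G.degree w := fun v => hw v (Finset.mem_univ v)
  have hw0 : 0 < G.degree w := by
    refine lt_of_lt_of_le ?_ (hw v₀)
    simpa [nonIsolated] using hv₀
  set S := nonIsolated (removeVerts G {w}) with hS
  set L := leafNeighbors G w with hL
  have hSn : S.card < n := by
    rw [← hn]
    refine Finset.card_lt_card ⟨?_, fun h => ?_⟩
    · rw [nonIsolated_eq G hw0]
      exact Finset.subset_union_right.trans (Finset.subset_insert _ _)
    · refine notMem_nonIsolated_removeVerts G (w := w) (h ?_)
      simpa [nonIsolated] using hw0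
  have hm : ∀ (G : SimpleGraph V) [DecidableRel G.Adj] (f : ∀ u v : V, Ω u × Ω v → ℝ≥0∞),
      (∀ u v, Measurable (f u v)) →
      Measurable fun x : (∀ v, Ω v) => edgeProd G (fun u v => f u v (x u, x v)) :=
    fun G _ f hf => measurable_edgeProd G (F := fun u v (x : ∀ v, Ω v) => f u v (x u, x v))
      fun u v => (hf u v).comp (by fun_prop)
  set Q : Ω w → ℝ≥0∞ := fun z => edgeProd (removeVerts G {w})
    (degreeNorm (removeVerts G {w}) μ (absorbedEdge G f w z)) with hQ
  have hQm : Measurable Q := measurable_edgeProd _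
    (F := fun u v z => degreeNorm (removeVerts G {w}) μ (absorbedEdge G f w z) u v) fun u v =>
      measurable_ebicliqueNorm_param _ _ _ _ (measurable_uncurry_absorbedEdge G hf u v)
  -- The variables of `w` and its leaves lie outside `S`, so the leaf factors come out and the
  -- induction hypothesis applies with `z = y w`.
  have hstep : ∀ y, (∫⋯∫⁻_S, (fun x => edgeProd G (fun u v => f u v (x u, x v))) ∂μ) y ≤
      Q (y w) * ∏ u ∈ L, f w u (y w, y u) := by
    intro y
    have hwS : w ∉ S := notMem_nonIsolated_removeVerts G
    have hLS : ∀ u ∈ L, u ∉ S := fun u hu => Finset.disjoint_left.1 (disjoint_leafNeighbors G) hu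
    have e : (∫⋯∫⁻_S, (fun x => edgeProd G (fun u v => f u v (x u, x v))) ∂μ) y =
        (∏ u ∈ L, f w u (y w, y u)) * (∫⋯∫⁻_S, (fun x => edgeProd (removeVerts G {w})
          (fun u v => absorbedEdge G f w (y w) u v (x u, x v))) ∂μ) y := by
      rw [← lmarginal_const_mul (k := fun x => ∏ u ∈ L, f w u (x w, x u))
        (hm _ _ (measurable_absorbedEdge G hf (y w)))]
      · refine lintegral_congr fun p => ?_
        have hwp : Function.updateFinset y S p w = y w := by simp [Function.updateFinset, hwS]
        beta_reduce
        rw [edgeProd_eq_absorbed G (w := w) hs, hwp]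
      · intro x hx
        refine Finset.prod_congr rfl fun u hu => ?_
        simp only [hx w hwS, hx u (hLS u hu)]
    rw [e, mul_comm]
    gcongr
    exact ih _ hSn (removeVerts G {w}) (fun u v x h h' h'' => hG u v x h.1 h'.1 h''.1) rfl _
      (measurable_absorbedEdge G hf (y w)) (absorbedEdge_symm G hs (y w)) y
  rw [nonIsolated_eq G hw0, lmarginal_insert _ (hm G f hf) (by
    rw [Finset.mem_union, not_or]
    exact ⟨notMem_leafNeighbors G, notMem_nonIsolated_removeVerts G⟩),
    lmarginal_union _ _ (hm G f hf) (disjoint_leafNeighbors G)]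
  refine le_trans (lintegral_mono fun z => ?_)
    (lintegral_prod_absorbedNorm_le G μ hG hf hs hw hw0)
  refine (lmarginal_mono (f := _) (g := fun y => Q (y w) * ∏ u ∈ L, f w u (y w, y u)) hstep _).trans
    (le_of_eq ?_)
  rw [lmarginal_const_mul (k := fun y => Q (y w)), mul_comm]
  · congr 1
    · rw [← lmarginal_finset_prod L (h := fun u t => f w u (z, t)) (μ := μ) (fun u => by fun_prop)
        (Function.update x w z)]
      refine lintegral_congr fun p => ?_
      have : Function.updateFinset (Function.update x w z) (leafNeighbors G w) p w = z := by
        simp [Function.updateFinset, notMem_leafNeighbors G]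
      simp only [hL, this]
      rfl
    · simp [hQ]
  · fun_prop
  · intro y hy
    simp only [hy w (notMem_leafNeighbors G)]

end Induction

theorem mainTheorem1 {V : Type*} [Fintype V] [DecidableEq V]
    (G : SimpleGraph V) [DecidableRel G.Adj]
    (hG : G.CliqueFree 3) (hiso : ∀ v : V, 0 < G.degree v)
    {Ω : V → Type*} [∀ v, MeasurableSpace (Ω v)]
    (μ : ∀ v, Measure (Ω v)) [∀ v, SigmaFinite (μ v)]
    (f : ∀ u v : V, Ω u × Ω v → ℝ≥0)
    (hf : ∀ u v, G.Adj u v → Measurable (f u v))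
    (hsymm : ∀ u v, G.Adj u v → ∀ (x : Ω u) (y : Ω v), f u v (x, y) = f v u (y, x)) :
    ∫⁻ x : (∀ v, Ω v), edgeProd G (fun u v => (f u v (x u, x v) : ℝ≥0∞)) ∂(Measure.pi μ)
      ≤ edgeProd G
          (fun u v => bicliqueNorm (μ u) (μ v) (G.degree v) (G.degree u) (f u v)) := by
  -- Setting the value to `1` on non-edges makes measurability and symmetry hold for all pairs.
  set g : ∀ u v : V, Ω u × Ω v → ℝ≥0∞ := fun u v p => if G.Adj u v then (f u v p : ℝ≥0∞) else 1
    with hg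
  have hgm : ∀ u v, Measurable (g u v) := by
    intro u v
    by_cases h : G.Adj u v
    · simpa [hg, h] using (hf u v h).coe_nnreal_ennreal
    · simp [hg, h]
  have hgs : ∀ u v x y, g u v (x, y) = g v u (y, x) := by
    intro u v x y
    by_cases h : G.Adj u v
    · simp [hg, h, h.symm, hsymm u v h x y]
    · simp [hg, h, G.adj_comm v u]
  have htri : ∀ u v x, G.Adj u v → G.Adj v x → ¬ G.Adj u x := fun u v x h h' h'' =>
    hG {u, v, x} (SimpleGraph.is3Clique_triple_iff.2 ⟨h, h'', h'⟩)
  have hS : nonIsolated G = Finset.univ := by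
    ext v; simp [nonIsolated, hiso v]
  -- A marginal integral needs a base point; without one the left side is zero.
  rcases isEmpty_or_nonempty (∀ v, Ω v) with hE | ⟨⟨x₀⟩⟩
  · simp [lintegral_of_isEmpty]
  have h := lmarginal_edgeProd_le μ _ G htri rfl g hgm hgs x₀
  rw [hS, lmarginal_univ] at h
  convert h using 1
  · refine lintegral_congr fun x => edgeProd_congr G fun u v huv => ?_
    simp [hg, huv]
  · refine edgeProd_congr G fun u v huv => ?_
    rw [bicliqueNorm_eq_ebicliqueNorm _ _ _ _ (hf u v huv), degreeNorm]
    simp [hg, huv]
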